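/- For a point $p=(a,b)\in\mathbb R^2$ let $p^\star=\{(x,y): y=ax-b\}$ be its dual line. Let $\mathcal P=\mathcal B\cup\mathcal R$ be a colour-separable set of $2n$ points: $\mathcal B$ (blue) and $\mathcal R$ (red) are finite subsets of $\mathbb R^2$ with $|\mathcal B|=|\mathcal R|=n$ that are strictly separated by a vertical line. Colour the dual lines of the blue points blue and those of the red points red, and let $\mathcal L$ be the resulting two-coloured line arrangement. Definitions. A pseudoline is a simple curve in the plane, both of whose ends go to infinity. Let $\mathcal A\subseteq\mathcal L$ have equally many blue and red lines. A directed pseudoline $\ell$ that crosses each line of $\mathcal A$ exactly once, the lines being crossed one at a time in the order $l_1,l_2,\dots,l_{|\mathcal A|}$, runs through a sequence $C_0,C_1,\dots,C_{|\mathcal A|}$ of cells of $\mathcal A$ (connected components of the complement of the union of the lines). It is M-semialternating for $\mathcal A$ if $l_i$ and $l_{i+1}$ have different colours for every odd $i<|\mathcal A|$, and the levels of $C_0,C_2,C_4,\dots,C_{|\mathcal A|}$ form a non-decreasing sequence, where the level of a cell is the number of lines of $\mathcal A$ below it. If such $\mathcal A$ and $\ell$ exist, $\mathcal L$ contains an M-semialternating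 path of size $|\mathcal A|$. A spoke set for $\mathcal P$ is a finite set of pairwise non-parallel lines such that every unbounded open region of their arrangement contains a point of $\mathcal P$; its size is the number of lines. A parallel set of size $m$ in $\mathcal P$ consists of non-vertical lines $L_0,L_1,\dots,L_m$ for which there are $B\subseteq\mathcal B$ and $R\subseteq\mathcal R$ with $|B|=|R|=m$ such that, for every $1\le i\le m$, the set of points of $B$ strictly above $L_{i-1}$ is a proper subset of the set of points of $B$ strictly above $L_i$, and likewise for $R$. Lemma. If $\mathcal L$ contains an M-semialternating path of size $2k$, then $\mathcal P$ has a spoke set of size at least $k/2$ or a parallel set of size at least $k/2$. -/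

import Mathlib

open Set Filter

/-- The Euclidean plane; only its affine structure, topology and bounded sets are used. -/
abbrev Plane : Type := ℝ × ℝ

/-- Affine subspaces of the plane; the lines among them are singled out by `IsLine`. -/
abbrev PlaneSubspace : Type := AffineSubspace ℝ Plane

/-- `l` is a line (possibly vertical). -/
def IsLine (l : PlaneSubspace) : Prop :=
  (l : Set Plane).Nonempty ∧ Module.finrank ℝ l.direction = 1

/-- `l` contains the vertical direction. -/
def IsVertical (l : PlaneSubspace) : Prop := ((0, 1) : Plane) ∈ l.direction

/-- The dual line `p⋆ = {(x, y) | y = a x - b}` of the point `p = (a, b)`. -/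
def dualLine (p : Plane) : PlaneSubspace where
  carrier := {q | q.2 = p.1 * q.1 - p.2}
  smul_vsub_vadd_mem' := by
    intro c q₁ q₂ q₃ h₁ h₂ h₃
    simp only [mem_ofPred_eq, vsub_eq_sub, vadd_eq_add, Prod.fst_add, Prod.snd_add,
      Prod.smul_fst, Prod.smul_snd, Prod.fst_sub, Prod.snd_sub, smul_eq_mul] at *
    rw [h₁, h₂, h₃]; ring

theorem mem_dualLine (p q : Plane) : q ∈ dualLine p ↔ q.2 = p.1 * q.1 - p.2 := Iff.rfl

/-- `q` is strictly above the non-vertical line `l`. -/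
def IsAbove (q : Plane) (l : PlaneSubspace) : Prop := ∃ y, ((q.1, y) : Plane) ∈ l ∧ y < q.2

/-- `q` is strictly below the non-vertical line `l`. -/
def IsBelow (q : Plane) (l : PlaneSubspace) : Prop := ∃ y, ((q.1, y) : Plane) ∈ l ∧ q.2 < y

/-- `C` is an open region (cell) of the arrangement `L`: a connected component of the
complement of the union of the lines. -/
def IsCell (L : Set PlaneSubspace) (C : Set Plane) : Prop :=
  ∃ q ∈ (⋃ l ∈ L, (l : Set Plane))ᶜ,
    C = connectedComponentIn (⋃ l ∈ L, (l : Set Plane))ᶜ q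

/-- The level of a cell of `L`: the number of lines of `L` that the cell is above. -/
noncomputable def cellLevel (L : Set PlaneSubspace) (C : Set Plane) : ℕ :=
  {l ∈ L | ∀ q ∈ C, IsAbove q l}.ncard

/-- A colour-separable point set: equally many blue points `B` and red points `R`,
strictly separated by a vertical line. -/
def IsColorSeparable (B R : Finset Plane) : Prop :=
  B.card = R.card ∧
    ∃ c : ℝ, ((∀ r ∈ R, r.1 < c) ∧ ∀ b ∈ B, c < b.1) ∨ ((∀ b ∈ B, b.1 < c) ∧ ∀ r ∈ R, c < r.1)

/-- `L` is a spoke set for `P`: pairwise non-parallel lines such that every unbounded open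
region of the arrangement contains a point of `P`. Its size is `L.card`. -/
def IsSpokeSet (P : Set Plane) (L : Finset PlaneSubspace) : Prop :=
  (∀ l ∈ L, IsLine l) ∧
  (∀ l ∈ L, ∀ l' ∈ L, l ≠ l' → ¬ l.Parallel l') ∧
  ∀ C : Set Plane, IsCell (L : Set PlaneSubspace) C → ¬ Bornology.IsBounded C → ∃ p ∈ P, p ∈ C

/-- The set of points of `P` above `l`. -/
def pointsAbove (P : Set Plane) (l : PlaneSubspace) : Set Plane := {p ∈ P | IsAbove p l}

/-- `L 0, …, L m` is a parallel set of size `m` in the two-coloured point set `B ∪ R`. -/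
def IsParallelSet (B R : Finset Plane) (m : ℕ) (L : Fin (m + 1) → PlaneSubspace) : Prop :=
  (∀ i, IsLine (L i) ∧ ¬ IsVertical (L i)) ∧
  ∃ B' ⊆ B, ∃ R' ⊆ R, B'.card = m ∧ R'.card = m ∧
    ∀ i : Fin m,
      pointsAbove B' (L i.castSucc) ⊂ pointsAbove B' (L i.succ) ∧
      pointsAbove R' (L i.castSucc) ⊂ pointsAbove R' (L i.succ)

/-- A parametrised (hence directed) pseudoline: a simple curve in the plane, both of whose
ends go to infinity. -/
structure IsPseudoline (γ : ℝ → Plane) : Prop where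
  continuous : Continuous γ
  injective : Function.Injective γ
  proper : Tendsto γ (cocompact ℝ) (cocompact Plane)

/-- The curve `γ` meets the non-vertical line `l` exactly once, at time `t`, and crosses it
there. -/
def CrossesAt (γ : ℝ → Plane) (l : PlaneSubspace) (t : ℝ) : Prop :=
  γ t ∈ l ∧
    (((∀ u < t, IsAbove (γ u) l) ∧ ∀ u > t, IsBelow (γ u) l) ∨
      ((∀ u < t, IsBelow (γ u) l) ∧ ∀ u > t, IsAbove (γ u) l))

/-- `C 0, …, C N` is the underlying cell-path, in the arrangement `A`, of the curve `γ` that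
crosses the lines of `A` at the times `t 0 < … < t (N - 1)`: `C j` is the cell that contains
the part of `γ` after the first `j` crossings and before the others. -/
def IsUnderlyingCellPath (A : Set PlaneSubspace) (γ : ℝ → Plane) {N : ℕ} (t : Fin N → ℝ)
    (C : Fin (N + 1) → Set Plane) : Prop :=
  ∀ j : Fin (N + 1), IsCell A (C j) ∧
    ∀ u : ℝ, (∀ i : Fin N, i.val < j.val → t i < u) → (∀ i : Fin N, j.val ≤ i.val → u < t i) →
      γ u ∈ C j

/-- The pseudoline `γ` is M-semialternating for the two-coloured arrangement with blue lines
`AB` and red lines `AR`. It crosses the lines of `AB ∪ AR`, once each, in the order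
`l 0, l 1, …` (numbered from `0`); the lines `l i` and `l (i + 1)` have different colours for
every even `i`; and the levels of the cells `C 0, C 2, C 4, …` of the underlying cell-path are
non-decreasing. -/
def IsMSemialternating (AB AR : Set PlaneSubspace) (γ : ℝ → Plane) : Prop :=
  IsPseudoline γ ∧
  ∃ (N : ℕ) (l : Fin N → PlaneSubspace) (t : Fin N → ℝ) (C : Fin (N + 1) → Set Plane),
    Function.Injective l ∧ range l = AB ∪ AR ∧
    StrictMono t ∧ (∀ i, CrossesAt γ (l i) (t i)) ∧
    (∀ i j : Fin N, Even i.val → j.val = i.val + 1 →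
      (l i ∈ AB ∧ l j ∈ AR) ∨ (l i ∈ AR ∧ l j ∈ AB)) ∧
    IsUnderlyingCellPath (AB ∪ AR) γ t C ∧
    (∀ i j : Fin (N + 1), Even i.val → Even j.val → i ≤ j →
      cellLevel (AB ∪ AR) (C i) ≤ cellLevel (AB ∪ AR) (C j))

/-- The two-coloured line arrangement with blue lines `LB` and red lines `LR` contains an
M-semialternating path of size `N`: some subarrangement of `N` lines, with equally many lines
of each colour, admits an M-semialternating pseudoline. -/
def ContainsMSemialternatingPath (LB LR : Set PlaneSubspace) (N : ℕ) : Prop :=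
  ∃ AB ⊆ LB, ∃ AR ⊆ LR, AB.ncard = AR.ncard ∧ (AB ∪ AR).ncard = N ∧
    ∃ γ : ℝ → Plane, IsMSemialternating AB AR γ

/-! The argument is by duality. The expression `p.2 + q.2 - p.1 * q.1` is symmetric in `p` and `q`,
and its sign tells on which side of `dualLine p` the point `q` lies. So a line of the arrangement
that is below a point `q` of the pseudoline is the dual of a point above `dualLine q`.

Group the `2 * k` crossings of the pseudoline into `k` consecutive pairs, each of a blue and a red
line. The level does not drop over a pair, so that at least one line of each pair is crossed
upwards (`exists_pairedCrossings`). Let `q i` be a point of the pseudoline just before the `i`-th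
pair.

If both lines are crossed upwards in at least half of the pairs, then on passing each of these
pairs one blue and one red line come to lie below the pseudoline. Hence the duals of the points
`q i`, and of a point at the end, form a parallel set (`PairedCrossings.isParallelSet`).

Otherwise more than half of the pairs have one line crossed upwards and one crossed downwards.
Both lines of such a pair separate the points `q` before it from those after it, which lie in
opposite wedges to the left and the right of the crossing point, because the two lines have
different slopes. Therefore the abscissae of the points `q i` are monotone in `i`
(`PairedCrossings.fst_between`). Their duals are pairwise non-parallel, and the sign vector of an
unbounded cell changes at most once in the order of slopes, since three lines with two sign
changes cut out a bounded triangle (`isBounded_of_sign_changes`). If the signs change after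
index `j`, then one of the two points whose dual lines form the `j`-th pair has the same sign
vector, and so it lies in the cell (`PairedCrossings.isSpokeSet`). -/

/-! ### The duality pairing -/

/-- The signed vertical distance from the line `dualLine p` up to the point `q`. -/
def dualPairing (p q : Plane) : ℝ := p.2 + q.2 - p.1 * q.1

theorem dualPairing_comm (p q : Plane) : dualPairing p q = dualPairing q p := by
  simp only [dualPairing]; ring

theorem mem_dualLine_iff_dualPairing (p q : Plane) : q ∈ dualLine p ↔ dualPairing p q = 0 := by
  rw [mem_dualLine, dualPairing]
  constructor <;> intro h <;> linarith

theorem isAbove_dualLine (p q : Plane) : IsAbove q (dualLine p) ↔ 0 < dualPairing p q := by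
  simp only [IsAbove, mem_dualLine, exists_eq_left, dualPairing]
  constructor <;> intro h <;> linarith

theorem isBelow_dualLine (p q : Plane) : IsBelow q (dualLine p) ↔ dualPairing p q < 0 := by
  simp only [IsBelow, mem_dualLine, exists_eq_left, dualPairing]
  constructor <;> intro h <;> linarith

theorem continuous_dualPairing (p : Plane) : Continuous (dualPairing p) := by
  unfold dualPairing; fun_prop

theorem dualLine_injective : Function.Injective dualLine := by
  intro p p' h
  have h0 : ((0, -p.2) : Plane) ∈ dualLine p' := h ▸ (mem_dualLine _ _).2 (by simp)
  have h1 : ((1, p.1 - p.2) : Plane) ∈ dualLine p' := h ▸ (mem_dualLine _ _).2 (by simp)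
  simp only [mem_dualLine] at h0 h1
  ext <;> linarith

/-! ### Dual lines as lines of the plane -/

theorem mem_direction_dualLine (p v : Plane) :
    v ∈ (dualLine p).direction ↔ v.2 = p.1 * v.1 := by
  have h0 : ((0, -p.2) : Plane) ∈ dualLine p := (mem_dualLine _ _).2 (by simp)
  rw [← AffineSubspace.vadd_mem_iff_mem_direction v h0, mem_dualLine]
  simp only [vadd_eq_add, Prod.fst_add, Prod.snd_add]
  constructor <;> intro h <;> linarith

theorem isLine_dualLine (p : Plane) : IsLine (dualLine p) := by
  refine ⟨⟨((0, -p.2) : Plane), (mem_dualLine _ _).2 (by simp)⟩, ?_⟩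
  have h : (dualLine p).direction = Submodule.span ℝ {((1, p.1) : Plane)} := by
    ext v
    rw [mem_direction_dualLine, Submodule.mem_span_singleton]
    constructor
    · intro hv
      exact ⟨v.1, by ext <;> simp [hv, mul_comm]⟩
    · rintro ⟨a, rfl⟩
      simp [mul_comm]
  rw [h, finrank_span_singleton (by simp)]

theorem not_isVertical_dualLine (p : Plane) : ¬ IsVertical (dualLine p) := by
  simp [IsVertical, mem_direction_dualLine]

theorem fst_eq_of_parallel_dualLine {p p' : Plane} (h : (dualLine p).Parallel (dualLine p')) :
    p.1 = p'.1 := by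
  have h1 : ((1, p.1) : Plane) ∈ (dualLine p').direction :=
    h.direction_eq ▸ (mem_direction_dualLine _ _).2 (by simp)
  simpa [mem_direction_dualLine] using h1

/-! ### Cells of an arrangement of dual lines -/

theorem mem_compl_iUnion_dualLine (S : Set Plane) (q : Plane) :
    q ∈ (⋃ l ∈ dualLine '' S, (l : Set Plane))ᶜ ↔ ∀ p ∈ S, dualPairing p q ≠ 0 := by
  simp only [mem_compl_iff, mem_iUnion, exists_prop, exists_mem_image, SetLike.mem_coe,
    mem_dualLine_iff_dualPairing, not_exists, not_and, ne_eq]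

theorem IsCell.nonempty {L : Set PlaneSubspace} {C : Set Plane} (hC : IsCell L C) :
    C.Nonempty := by
  obtain ⟨q, hq, rfl⟩ := hC
  exact ⟨q, mem_connectedComponentIn hq⟩

theorem IsCell.dualPairing_ne_zero {S : Set Plane} {C : Set Plane}
    (hC : IsCell (dualLine '' S) C) {p q : Plane} (hp : p ∈ S) (hq : q ∈ C) :
    dualPairing p q ≠ 0 := by
  obtain ⟨z, hz, rfl⟩ := hC
  exact (mem_compl_iUnion_dualLine S q).1 (connectedComponentIn_subset _ _ hq) p hp

theorem IsCell.dualPairing_pos {S : Set Plane} {C : Set Plane}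
    (hC : IsCell (dualLine '' S) C) {p q q' : Plane} (hp : p ∈ S) (hq : q ∈ C) (hq' : q' ∈ C)
    (h : 0 < dualPairing p q) : 0 < dualPairing p q' := by
  by_contra hneg
  have hpre : IsPreconnected C := by
    obtain ⟨z, hz, rfl⟩ := hC
    exact isPreconnected_connectedComponentIn
  obtain ⟨w, hw, hw0⟩ := hpre.intermediate_value hq' hq
    (continuous_dualPairing p).continuousOn ⟨not_lt.1 hneg, h.le⟩
  exact hC.dualPairing_ne_zero hp hw hw0

theorem IsCell.isAbove_iff {S : Set Plane} {C : Set Plane} (hC : IsCell (dualLine '' S) C)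
    {p q : Plane} (hp : p ∈ S) (hq : q ∈ C) :
    (∀ z ∈ C, IsAbove z (dualLine p)) ↔ 0 < dualPairing p q := by
  simp only [isAbove_dualLine]
  exact ⟨fun h => h q hq, fun h z hz => hC.dualPairing_pos hp hq hz h⟩

/-- A point with the sign vector of a cell lies in the cell, as the segment from it to a point
of the cell meets no line. -/
theorem IsCell.mem_of_same_sides {S : Set Plane} {C : Set Plane}
    (hC : IsCell (dualLine '' S) C) {z w : Plane} (hz : z ∈ C)
    (h : ∀ p ∈ S, 0 < dualPairing p z * dualPairing p w) : w ∈ C := by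
  obtain ⟨x, hx, rfl⟩ := hC
  rw [connectedComponentIn_eq hz]
  refine (convex_segment (𝕜 := ℝ) z w).isPreconnected.subset_connectedComponentIn
    (left_mem_segment ℝ z w) ?_ (right_mem_segment ℝ z w)
  rintro _ ⟨a, b, ha, hb, hab, rfl⟩
  refine (mem_compl_iUnion_dualLine S _).2 fun p hp => ?_
  have hcomb : dualPairing p (a • z + b • w) = a * dualPairing p z + b * dualPairing p w := by
    simp only [dualPairing, Prod.fst_add, Prod.snd_add, Prod.smul_fst, Prod.smul_snd, smul_eq_mul]
    linear_combination (-p.2) * hab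
  rw [hcomb]
  rcases mul_pos_iff.1 (h p hp) with ⟨h1, h2⟩ | ⟨h1, h2⟩
  · rcases ha.eq_or_lt with rfl | ha
    · obtain rfl : b = 1 := by linarith
      linarith
    · have := mul_pos ha h1
      have := mul_nonneg hb h2.le
      linarith
  · rcases ha.eq_or_lt with rfl | ha
    · obtain rfl : b = 1 := by linarith
      linarith
    · have := mul_neg_of_pos_of_neg ha h1
      have := mul_nonpos_of_nonneg_of_nonpos hb h2.le
      linarith

/-- If the slope of `dualLine p₂` is between those of `dualLine p₁` and `dualLine p₃`, then the
points that are above the second line and below the two others, or the other way round, form a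
bounded set: a triangle, or nothing. -/
theorem isBounded_of_sign_changes {p₁ p₂ p₃ : Plane}
    (hp : (p₁.1 - p₂.1) * (p₃.1 - p₂.1) < 0) {C : Set Plane}
    (h₁ : ∀ z ∈ C, dualPairing p₁ z * dualPairing p₂ z < 0)
    (h₃ : ∀ z ∈ C, dualPairing p₃ z * dualPairing p₂ z < 0) : Bornology.IsBounded C := by
  have hne₁ : p₁.1 - p₂.1 ≠ 0 := left_ne_zero_of_mul hp.ne
  have hne₃ : p₃.1 - p₂.1 ≠ 0 := right_ne_zero_of_mul hp.ne
  -- The abscissae of the points where the second line meets the first and the third line.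
  set a := (p₁.2 - p₂.2) / (p₁.1 - p₂.1) with ha
  set b := (p₃.2 - p₂.2) / (p₃.1 - p₂.1) with hb
  set M := |a| + |b| with hM
  set K := |p₁.2| + |p₁.1| * M + (|p₁.2 - p₂.2| + |p₁.1 - p₂.1| * M) with hK
  refine (Metric.isBounded_Icc ((-M, -K) : Plane) (M, K)).subset fun z hz => ?_
  have e₁ : dualPairing p₁ z - dualPairing p₂ z = -(p₁.1 - p₂.1) * (z.1 - a) := by
    rw [ha, dualPairing, dualPairing]; field_simp; ring
  have e₃ : dualPairing p₃ z - dualPairing p₂ z = -(p₃.1 - p₂.1) * (z.1 - b) := by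
    rw [hb, dualPairing, dualPairing]; field_simp; ring
  have hprod : 0 < (dualPairing p₁ z - dualPairing p₂ z) *
      (dualPairing p₃ z - dualPairing p₂ z) := by
    rcases mul_neg_iff.1 (h₁ z hz) with ⟨s₁, s₂⟩ | ⟨s₁, s₂⟩ <;>
      rcases mul_neg_iff.1 (h₃ z hz) with ⟨s₃, s₄⟩ | ⟨s₃, s₄⟩
    · exact mul_pos (by linarith) (by linarith)
    · linarith
    · linarith
    · exact mul_pos_of_neg_of_neg (by linarith) (by linarith)
  have hx : (z.1 - a) * (z.1 - b) < 0 := by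
    rw [e₁, e₃] at hprod
    by_contra hx
    have := mul_nonpos_of_nonpos_of_nonneg hp.le (not_lt.1 hx)
    linarith
  have hzM : |z.1| ≤ M := by
    rw [abs_le, hM]
    have := neg_abs_le a
    have := neg_abs_le b
    have := le_abs_self a
    have := le_abs_self b
    rcases mul_neg_iff.1 hx with ⟨s, s'⟩ | ⟨s, s'⟩ <;> constructor <;>
      linarith [abs_nonneg a, abs_nonneg b]
  have hg : |dualPairing p₁ z| ≤ |dualPairing p₁ z - dualPairing p₂ z| := by
    rcases mul_neg_iff.1 (h₁ z hz) with ⟨s₁, s₂⟩ | ⟨s₁, s₂⟩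
    · rw [abs_of_pos s₁, abs_of_pos (by linarith)]; linarith
    · rw [abs_of_neg s₁, abs_of_neg (by linarith)]; linarith
  have hd : |dualPairing p₁ z - dualPairing p₂ z| ≤ |p₁.2 - p₂.2| + |p₁.1 - p₂.1| * M := by
    have e : dualPairing p₁ z - dualPairing p₂ z = (p₁.2 - p₂.2) - (p₁.1 - p₂.1) * z.1 := by
      simp only [dualPairing]; ring
    rw [e]
    refine (abs_sub _ _).trans ?_
    rw [abs_mul]
    gcongr
  have hzK : |z.2| ≤ K := by
    have e : z.2 = -p₁.2 + p₁.1 * z.1 + dualPairing p₁ z := by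
      simp only [dualPairing]; ring
    have h4 : |z.2| ≤ |p₁.2| + |p₁.1| * |z.1| + |dualPairing p₁ z| := by
      conv_lhs => rw [e]
      refine (abs_add_three _ _ _).trans ?_
      rw [abs_neg, abs_mul]
    have h5 : |p₁.1| * |z.1| ≤ |p₁.1| * M := by gcongr
    linarith
  exact ⟨⟨(abs_le.1 hzM).1, (abs_le.1 hzK).1⟩, ⟨(abs_le.1 hzM).2, (abs_le.1 hzK).2⟩⟩

/-! ### The crossings of the pseudoline in pairs -/

/-- A discrete record of a curve that crosses `k` consecutive pairs of dual lines. The `i`-th pair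
is dual to the blue point `b i` and the red point `r i`, and `q j` is a point of the curve after
the first `j` pairs and before the others. The propositions `ub i` and `ur i` say that the
curve crosses `dualLine (b i)` and `dualLine (r i)` upwards. -/
structure PairedCrossings (B R : Finset Plane) {k : ℕ} (b r : Fin k → Plane) (q : ℕ → Plane)
    (ub ur : Fin k → Prop) : Prop where
  blue_mem : ∀ i, b i ∈ B
  red_mem : ∀ i, r i ∈ R
  blue_injective : Function.Injective b
  red_injective : Function.Injective r
  up : ∀ i, ub i ∨ ur i
  blue_ne_zero : ∀ i j, dualPairing (b i) (q j) ≠ 0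
  red_ne_zero : ∀ i j, dualPairing (r i) (q j) ≠ 0
  blue_pos : ∀ i j, 0 < dualPairing (b i) (q j) ↔ (ub i ↔ (i : ℕ) < j)
  red_pos : ∀ i j, 0 < dualPairing (r i) (q j) ↔ (ur i ↔ (i : ℕ) < j)

/-- The side of the curve relative to a line it crosses at time `t` is encoded by one proposition
`up`, the direction of the crossing: the curve is above the line after `t` if `up` holds, and
before `t` otherwise. -/
theorem CrossesAt.exists_up {γ : ℝ → Plane} {p : Plane} {t : ℝ}
    (h : CrossesAt γ (dualLine p) t) :
    ∃ up : Prop, ∀ u, u ≠ t →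
      dualPairing p (γ u) ≠ 0 ∧ (0 < dualPairing p (γ u) ↔ (up ↔ t < u)) := by
  simp only [CrossesAt, isAbove_dualLine, isBelow_dualLine] at h
  rcases h.2 with ⟨h1, h2⟩ | ⟨h1, h2⟩
  · refine ⟨False, fun u hu => ?_⟩
    rcases lt_or_gt_of_ne hu with hu | hu
    · simp [h1 u hu, (h1 u hu).ne', hu.le]
    · simp [(h2 u hu).le, (h2 u hu).ne, hu]
  · refine ⟨True, fun u hu => ?_⟩
    rcases lt_or_gt_of_ne hu with hu | hu
    · simp [(h1 u hu).ne, not_lt.2 (h1 u hu).le, not_lt.2 hu.le]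
    · simp [h2 u hu, (h2 u hu).ne', hu]

theorem StrictMono.exists_between_fin {N : ℕ} {t : Fin N → ℝ} (ht : StrictMono t) (j : ℕ) :
    ∃ u : ℝ, (∀ i : Fin N, i.val < j → t i < u) ∧ ∀ i : Fin N, j ≤ i.val → u < t i := by
  obtain ⟨u, h1, h2⟩ := Order.exists_between_finsets
    ((Finset.univ.filter fun i : Fin N => i.val < j).image t)
    ((Finset.univ.filter fun i : Fin N => j ≤ i.val).image t) (by
      simp only [Finset.mem_image, Finset.mem_filter, Finset.mem_univ, true_and]
      rintro _ ⟨i, hi, rfl⟩ _ ⟨i', hi', rfl⟩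
      exact ht (Fin.lt_def.2 (hi.trans_le hi')))
  simp only [Finset.mem_image, Finset.mem_filter, Finset.mem_univ, true_and,
    forall_exists_index, and_imp] at h1 h2
  exact ⟨u, fun i hi => h1 _ i hi rfl, fun i hi => h2 _ i hi rfl⟩

/-- The colour classes and the order of crossing of an M-semialternating path come down to paired
crossings; since the level does not drop over a pair, some line of the pair is crossed upwards. -/
theorem exists_pairedCrossings {k : ℕ} {B R : Finset Plane}
    (hpath : ContainsMSemialternatingPath (dualLine '' (B : Set Plane))
      (dualLine '' (R : Set Plane)) (2 * k)) :
    ∃ (b r : Fin k → Plane) (q : ℕ → Plane) (ub ur : Fin k → Prop),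
      PairedCrossings B R b r q ub ur := by
  obtain ⟨AB, hAB, AR, hAR, -, hcard, γ, -, N, l, t, C, hl, hrange, ht, hcross, hcol, hpath,
    hlevel⟩ := hpath
  obtain rfl : N = 2 * k := by
    rw [← hcard, ← hrange, ← Set.image_univ, Set.ncard_image_of_injective _ hl,
      Set.ncard_univ, Nat.card_fin]
  have hdual : ∀ i, ∃ p, dualLine p = l i := by
    intro i
    have hi : l i ∈ AB ∪ AR := hrange ▸ Set.mem_range_self i
    rcases hi with hi | hi
    · obtain ⟨p, -, hp⟩ := hAB hi
      exact ⟨p, hp⟩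
    · obtain ⟨p, -, hp⟩ := hAR hi
      exact ⟨p, hp⟩
  choose p hp using hdual
  have hpinj : Function.Injective p := fun i j hij => hl (by rw [← hp i, ← hp j, hij])
  have hpB : ∀ i, l i ∈ AB → p i ∈ B := by
    intro i hi
    obtain ⟨x, hx, hxl⟩ := hAB hi
    rwa [dualLine_injective ((hp i).trans hxl.symm)]
  have hpR : ∀ i, l i ∈ AR → p i ∈ R := by
    intro i hi
    obtain ⟨x, hx, hxl⟩ := hAR hi
    rwa [dualLine_injective ((hp i).trans hxl.symm)]
  have hA : AB ∪ AR = dualLine '' range p := by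
    rw [← hrange, ← Set.range_comp]
    exact congrArg range (funext fun i => (hp i).symm)
  choose up hup using fun i => (hp i ▸ hcross i : CrossesAt γ (dualLine (p i)) (t i)).exists_up
  choose u hu1 hu2 using ht.exists_between_fin
  have hune : ∀ i j, u j ≠ t i := by
    intro i j
    rcases lt_or_ge i.val j with h | h
    · exact (hu1 j i h).ne'
    · exact (hu2 j i h).ne
  have htu : ∀ i j, t i < u j ↔ i.val < j := by
    intro i j
    refine ⟨fun h => ?_, hu1 j i⟩
    by_contra hij
    exact lt_asymm h (hu2 j i (not_lt.1 hij))
  have hside : ∀ i j, 0 < dualPairing (p i) (γ (u j)) ↔ (up i ↔ i.val < j) := by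
    intro i j
    rw [(hup i _ (hune i j)).2, htu]
  have hbelow : ∀ (i : Fin (2 * k)) (j : Fin (2 * k + 1)),
      (∀ z ∈ C j, IsAbove z (l i)) ↔ (up i ↔ i.val < j.val) := by
    intro i j
    have hcell := (hpath j).1
    rw [hA] at hcell
    rw [← hp i, hcell.isAbove_iff (Set.mem_range_self i)
      ((hpath j).2 (u j) (hu1 j) (hu2 j)), hside]
  have hpair : ∀ i : ℕ, ∀ h : 2 * i + 1 < 2 * k, up ⟨2 * i, by omega⟩ ∨ up ⟨2 * i + 1, h⟩ := by
    intro i h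
    by_contra hno
    rw [not_or] at hno
    have hle := hlevel ⟨2 * i, by omega⟩ ⟨2 * i + 2, by omega⟩ (even_two_mul i)
      (by simp [parity_simps]) (Fin.le_def.2 (by simp))
    -- If both lines were crossed downwards, the set of lines below the curve would only lose
    -- elements over the pair, so the level would drop.
    refine absurd hle (not_le.2 ?_)
    have hfin : (AB ∪ AR).Finite := hrange ▸ Set.finite_range l
    refine Set.ncard_lt_ncard ?_ (hfin.subset fun x hx => hx.1)
    rw [Set.ssubset_iff_of_subset]
    · refine ⟨l ⟨2 * i, by omega⟩, ⟨hrange ▸ Set.mem_range_self _, ?_⟩, fun hmem => ?_⟩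
      · rw [hbelow]; simp [hno.1]
      · have := (hbelow _ _).1 hmem.2
        simp [hno.1] at this
    · rintro x ⟨hx, hxC⟩
      refine ⟨hx, ?_⟩
      rw [← hrange] at hx
      obtain ⟨m, rfl⟩ := hx
      rw [hbelow] at hxC ⊢
      rcases lt_trichotomy m.val (2 * i) with hm | hm | hm
      · simpa [hm, show m.val < 2 * i + 2 by omega] using hxC
      · have hm' : m = ⟨2 * i, by omega⟩ := Fin.ext hm
        rw [hm']
        simp [hno.1]
      · by_cases hm2 : m.val = 2 * i + 1
        · have hm' : m = ⟨2 * i + 1, h⟩ := Fin.ext hm2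
          rw [hm']
          simp [hno.2]
        · simpa [show ¬ m.val < 2 * i by omega, show ¬ m.val < 2 * i + 2 by omega] using hxC
  -- The two indices `2 * i` and `2 * i + 1`, with the blue line first, are characterised by
  -- having quotient `i` on division by `2`; this gives both injectivity and the order of crossing.
  have hindex : ∀ i : Fin k, ∃ β ρ : Fin (2 * k), β.val / 2 = i ∧ ρ.val / 2 = i ∧
      p β ∈ B ∧ p ρ ∈ R ∧ (up β ∨ up ρ) := by
    intro i
    have hi := i.isLt
    have hupi := hpair i (by omega)
    rcases hcol ⟨2 * i, by omega⟩ ⟨2 * i + 1, by omega⟩ (even_two_mul _) rfl with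
      ⟨h1, h2⟩ | ⟨h1, h2⟩
    · exact ⟨_, _, by simp, by simp; omega, hpB _ h1, hpR _ h2, hupi⟩
    · exact ⟨_, _, by simp; omega, by simp, hpB _ h2, hpR _ h1, hupi.symm⟩
  choose β ρ hβ hρ hβB hρR hβρ using hindex
  refine ⟨p ∘ β, p ∘ ρ, fun j => γ (u (2 * j)), up ∘ β, up ∘ ρ, hβB, hρR, ?_, ?_, hβρ,
    fun i j => (hup _ _ (hune _ _)).1, fun i j => (hup _ _ (hune _ _)).1, ?_, ?_⟩
  · intro i i' h
    have := hpinj h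
    exact Fin.ext (by rw [← hβ i, ← hβ i', this])
  · intro i i' h
    have := hpinj h
    exact Fin.ext (by rw [← hρ i, ← hρ i', this])
  · intro i j
    have := hβ i
    simp only [Function.comp_apply, hside, show (β i).val < 2 * j ↔ i.val < j by omega]
  · intro i j
    have := hρ i
    simp only [Function.comp_apply, hside, show (ρ i).val < 2 * j ↔ i.val < j by omega]

/-! ### Pairs crossed upwards give a parallel set -/

theorem pointsAbove_ssubset {k : ℕ} {x : Fin k → Plane} {q : ℕ → Plane} {S : Finset (Fin k)}
    (hpos : ∀ i ∈ S, ∀ j, 0 < dualPairing (x i) (q j) ↔ i.val < j)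
    {i : Fin k} (hi : i ∈ S) {j : ℕ} (hij : i.val < j) :
    pointsAbove (S.image x : Finset Plane) (dualLine (q i)) ⊂
      pointsAbove (S.image x : Finset Plane) (dualLine (q j)) := by
  have hmem : ∀ i' ∈ S, ∀ j, x i' ∈ pointsAbove (S.image x : Finset Plane) (dualLine (q j)) ↔
      i'.val < j := by
    intro i' hi' j
    rw [← hpos i' hi', dualPairing_comm, ← isAbove_dualLine]
    exact ⟨fun h => h.2, fun h => ⟨Finset.mem_coe.2 (Finset.mem_image_of_mem _ hi'), h⟩⟩
  rw [Set.ssubset_iff_of_subset]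
  · exact ⟨x i, (hmem i hi j).2 hij, fun h => lt_irrefl _ ((hmem i hi i).1 h)⟩
  · intro z hz
    obtain ⟨i', hi', rfl⟩ := Finset.mem_image.1 (Finset.mem_coe.1 hz.1)
    exact (hmem i' hi' j).2 (((hmem i' hi' i).1 hz).trans hij)

namespace PairedCrossings

variable {B R : Finset Plane} {k : ℕ} {b r : Fin k → Plane} {q : ℕ → Plane}
  {ub ur : Fin k → Prop}

theorem isParallelSet (h : PairedCrossings B R b r q ub ur) {S : Finset (Fin k)}
    (hS : ∀ i ∈ S, ub i ∧ ur i) :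
    ∃ L : Fin (S.card + 1) → PlaneSubspace, IsParallelSet B R S.card L := by
  set e := S.orderEmbOfFin rfl
  -- The lines are taken just before the pairs of `S`, and one after all pairs.
  let f : Fin (S.card + 1) → ℕ := Fin.snoc (α := fun _ => ℕ) (fun i => (e i : ℕ)) k
  have hf : ∀ i : Fin S.card, f i.castSucc = e i := fun i => by simp [f]
  have hf' : ∀ i : Fin S.card, (e i : ℕ) < f i.succ := by
    intro i
    rcases Fin.eq_castSucc_or_eq_last i.succ with ⟨j, hj⟩ | hj
    · rw [hj, hf]
      have hij : i < j := by
        rw [← Fin.castSucc_lt_castSucc_iff, ← hj]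
        exact Fin.castSucc_lt_succ
      exact Fin.lt_def.1 (e.strictMono hij)
    · rw [hj]
      simp [f]
  refine ⟨fun i => dualLine (q (f i)),
    fun i => ⟨isLine_dualLine _, not_isVertical_dualLine _⟩, S.image b, ?_, S.image r, ?_,
    Finset.card_image_of_injective _ h.blue_injective,
    Finset.card_image_of_injective _ h.red_injective, fun i => ?_⟩
  · exact Finset.image_subset_iff.2 fun i _ => h.blue_mem i
  · exact Finset.image_subset_iff.2 fun i _ => h.red_mem i
  · have hi : e i ∈ S := S.orderEmbOfFin_mem rfl i
    beta_reduce
    rw [hf]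
    exact ⟨pointsAbove_ssubset (x := b)
        (fun i hi j => by simp [h.blue_pos, (hS i hi).1]) hi (hf' i),
      pointsAbove_ssubset (x := r)
        (fun i hi j => by simp [h.red_pos, (hS i hi).2]) hi (hf' i)⟩

end PairedCrossings

/-! ### Pairs crossed in opposite directions give a spoke set -/

/-- A predicate on a nonempty finite linear order that does not change twice is constant on an
initial segment and takes the other value afterwards. -/
theorem exists_cut {α : Type*} [LinearOrder α] {T : Finset α} (hT : T.Nonempty) {A : α → Prop}
    (h : ∀ i ∈ T, ∀ j ∈ T, ∀ m ∈ T, i < j → j < m → (A i ↔ ¬ A j) → (A m ↔ ¬ A j) → False) :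
    ∃ a : Prop, ∃ j ∈ T, ∀ i ∈ T, A i ↔ (a ↔ i ≤ j) := by
  classical
  set m₀ := T.min' hT
  have hm₀ : m₀ ∈ T := T.min'_mem hT
  set U := T.filter fun i => ∀ i' ∈ T, i' ≤ i → (A i' ↔ A m₀) with hU
  have hUne : U.Nonempty := by
    refine ⟨m₀, Finset.mem_filter.2 ⟨hm₀, fun i' hi' hle => ?_⟩⟩
    rw [le_antisymm hle (T.min'_le i' hi')]
  have hjU : U.max' hUne ∈ U := U.max'_mem hUne
  refine ⟨A m₀, U.max' hUne, (Finset.mem_filter.1 hjU).1, fun i hi => ?_⟩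
  by_cases hle : i ≤ U.max' hUne
  · simpa [hle] using (Finset.mem_filter.1 hjU).2 i hi hle
  · have hnot : i ∉ U := fun hiU => hle (U.le_max' i hiU)
    have hne : ¬ (A i ↔ A m₀) := by
      intro hAi
      simp only [hU, Finset.mem_filter, hi, true_and, not_forall] at hnot
      obtain ⟨i', hi', hi'i, hA⟩ := hnot
      have h1 : m₀ < i' := lt_of_le_of_ne (T.min'_le i' hi') (by rintro heq; exact hA (by rw [heq]))
      have h2 : i' < i := lt_of_le_of_ne hi'i (by rintro rfl; exact hA hAi)
      exact h m₀ hm₀ i' hi' i hi h1 h2 (by tauto) (by tauto)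
    simp only [hle, iff_false]
    tauto

namespace PairedCrossings

variable {B R : Finset Plane} {k : ℕ} {b r : Fin k → Plane} {q : ℕ → Plane}
  {ub ur : Fin k → Prop}

/-- The points of the curve before and after a pair that is crossed in opposite directions lie in
the two opposite wedges of the pair that are to the left and to the right of its crossing
point. -/
theorem fst_separated (h : PairedCrossings B R b r q ub ur) {i : Fin k}
    (hi : ub i ↔ ¬ ur i) (hslope : (b i).1 ≠ (r i).1) :
    (∀ j j', j ≤ i.val → i.val < j' → (q j).1 < (q j').1) ∨
      (∀ j j', j ≤ i.val → i.val < j' → (q j').1 < (q j).1) := by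
  -- For `q j` and `q j'` on different sides of both lines, subtracting the two pairings cancels
  -- the ordinates and leaves the difference of slopes times the difference of abscissae.
  have key : ∀ j j', j ≤ i.val → i.val < j' →
      ((ub i → 0 < ((b i).1 - (r i).1) * ((q j).1 - (q j').1)) ∧
        (¬ ub i → ((b i).1 - (r i).1) * ((q j).1 - (q j').1) < 0)) := by
    intro j j' hj hj'
    have b1 := h.blue_pos i j
    have b2 := h.blue_pos i j'
    have r1 := h.red_pos i j
    have r2 := h.red_pos i j'
    have nb1 := h.blue_ne_zero i j
    have nb2 := h.blue_ne_zero i j'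
    have nr1 := h.red_ne_zero i j
    have nr2 := h.red_ne_zero i j'
    simp only [not_lt.2 hj, hj', iff_false, iff_true] at b1 b2 r1 r2
    have e : ((b i).1 - (r i).1) * ((q j).1 - (q j').1) =
        dualPairing (b i) (q j') - dualPairing (b i) (q j) +
          (dualPairing (r i) (q j) - dualPairing (r i) (q j')) := by
      simp only [dualPairing]; ring
    rw [e]
    constructor
    · intro hub
      have hur : ¬ ur i := hi.1 hub
      have c1 : dualPairing (b i) (q j) < 0 :=
        lt_of_le_of_ne (not_lt.1 fun hh => b1.1 hh hub) nb1
      have c2 := b2.2 hub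
      have c3 := r1.2 hur
      have c4 : dualPairing (r i) (q j') < 0 :=
        lt_of_le_of_ne (not_lt.1 fun hh => hur (r2.1 hh)) nr2
      linarith
    · intro hub
      have hur : ur i := by by_contra hh; exact hub (hi.2 hh)
      have c1 := b1.2 hub
      have c2 : dualPairing (b i) (q j') < 0 :=
        lt_of_le_of_ne (not_lt.1 fun hh => hub (b2.1 hh)) nb2
      have c3 : dualPairing (r i) (q j) < 0 :=
        lt_of_le_of_ne (not_lt.1 fun hh => r1.1 hh hur) nr1
      have c4 := r2.2 hur
      linarith
  by_cases hub : ub i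
  · rcases lt_or_gt_of_ne hslope with hs | hs
    · left
      intro j j' hj hj'
      exact sub_neg.1 (neg_of_mul_pos_right ((key j j' hj hj').1 hub) (sub_neg.2 hs).le)
    · right
      intro j j' hj hj'
      exact sub_pos.1 (pos_of_mul_pos_right ((key j j' hj hj').1 hub) (sub_pos.2 hs).le)
  · rcases lt_or_gt_of_ne hslope with hs | hs
    · right
      intro j j' hj hj'
      exact sub_pos.1 (pos_of_mul_neg_right ((key j j' hj hj').2 hub) (sub_neg.2 hs).le)
    · left
      intro j j' hj hj'
      exact sub_neg.1 (neg_of_mul_neg_right ((key j j' hj hj').2 hub) (sub_pos.2 hs).le)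

/-- The abscissa of `q j` is between those of `q i` and `q m`: both pairs `i` and `j` separate
`q i` from `q m`, so they agree on whether the curve passes from left to right. -/
theorem fst_between (h : PairedCrossings B R b r q ub ur) {i j : Fin k} {m : ℕ}
    (hi : ub i ↔ ¬ ur i) (hj : ub j ↔ ¬ ur j)
    (hsi : (b i).1 ≠ (r i).1) (hsj : (b j).1 ≠ (r j).1) (hij : i < j) (hjm : j.val < m) :
    ((q i).1 - (q j).1) * ((q m).1 - (q j).1) < 0 := by
  have hij' : i.val < j.val := hij
  rcases h.fst_separated hi hsi with s | s <;> rcases h.fst_separated hj hsj with s' | s'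
  · exact mul_neg_of_neg_of_pos (sub_neg.2 (s _ _ le_rfl hij')) (sub_pos.2 (s' _ _ le_rfl hjm))
  · exact absurd (s _ _ le_rfl (hij'.trans hjm)) (lt_asymm (s' _ _ hij'.le hjm))
  · exact absurd (s _ _ le_rfl (hij'.trans hjm)) (lt_asymm (s' _ _ hij'.le hjm))
  · exact mul_neg_of_pos_of_neg (sub_pos.2 (s _ _ le_rfl hij')) (sub_neg.2 (s' _ _ le_rfl hjm))

theorem isSpokeSet (h : PairedCrossings B R b r q ub ur) {T : Finset (Fin k)} (hne : T.Nonempty)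
    (hT : ∀ i ∈ T, (ub i ↔ ¬ ur i)) (hslope : ∀ i, (b i).1 ≠ (r i).1) :
    ∃ L : Finset PlaneSubspace, IsSpokeSet ((B : Set Plane) ∪ (R : Set Plane)) L ∧
      L.card = T.card := by
  classical
  have hfst : ∀ i ∈ T, ∀ j ∈ T, i ≠ j → (q i).1 ≠ (q j).1 := by
    have hlt : ∀ i ∈ T, ∀ j : Fin k, i < j → (q i).1 ≠ (q j).1 := by
      intro i hi j hij
      rcases h.fst_separated (hT i hi) (hslope i) with s | s
      · exact (s _ _ le_rfl hij).ne
      · exact (s _ _ le_rfl hij).ne'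
    intro i hi j hj hij
    rcases lt_or_gt_of_ne hij with hij | hij
    · exact hlt i hi j hij
    · exact (hlt j hj i hij).symm
  refine ⟨T.image fun i : Fin k => dualLine (q i), ⟨?_, ?_, ?_⟩, Finset.card_image_of_injOn ?_⟩
  · simp only [Finset.mem_image]
    rintro _ ⟨i, -, rfl⟩
    exact isLine_dualLine _
  · simp only [Finset.mem_image]
    rintro _ ⟨i, hi, rfl⟩ _ ⟨j, hj, rfl⟩ hij hpar
    exact hfst i hi j hj (by rintro rfl; exact hij rfl) (fst_eq_of_parallel_dualLine hpar)
  · intro C hC hunb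
    have himg : ((T.image fun i : Fin k => dualLine (q i) : Finset PlaneSubspace) : Set PlaneSubspace) =
        dualLine '' ((fun i : Fin k => q i) '' (T : Set (Fin k))) := by
      rw [Finset.coe_image, Set.image_image]
    rw [himg] at hC
    obtain ⟨z, hz⟩ := hC.nonempty
    have hmem : ∀ i ∈ T, q i ∈ (fun i : Fin k => q i) '' (T : Set (Fin k)) :=
      fun i hi => Set.mem_image_of_mem _ hi
    -- Different signs at one point of the cell are different signs throughout the cell.
    have hneg : ∀ i ∈ T, ∀ j ∈ T,
        ((0 < dualPairing (q i) z) ↔ ¬ 0 < dualPairing (q j) z) →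
        ∀ w ∈ C, dualPairing (q i) w * dualPairing (q j) w < 0 := by
      intro i hi j hj hij w hw
      have ni := hC.dualPairing_ne_zero (hmem i hi) hw
      have nj := hC.dualPairing_ne_zero (hmem j hj) hw
      by_cases hiz : 0 < dualPairing (q i) z
      · refine mul_neg_of_pos_of_neg (hC.dualPairing_pos (hmem i hi) hz hw hiz)
          (lt_of_le_of_ne (not_lt.1 fun hh => ?_) nj)
        exact hij.1 hiz (hC.dualPairing_pos (hmem j hj) hw hz hh)
      · have hjz : 0 < dualPairing (q j) z := by tauto
        refine mul_neg_of_neg_of_pos (lt_of_le_of_ne (not_lt.1 fun hh => ?_) ni)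
          (hC.dualPairing_pos (hmem j hj) hz hw hjz)
        exact hiz (hC.dualPairing_pos (hmem i hi) hw hz hh)
    obtain ⟨a, j, hj, hcut⟩ := exists_cut (A := fun i : Fin k => 0 < dualPairing (q i) z) hne (by
      intro i hi j hj m hm hij hjm hA hA'
      exact hunb (isBounded_of_sign_changes
        (h.fst_between (hT i hi) (hT j hj) (hslope i) (hslope j) hij hjm)
        (hneg i hi j hj hA) (hneg m hm j hj hA')))
    -- Of the two points of the `j`-th pair, the one whose dual line is crossed downwards if the
    -- cell is above the first lines, and upwards if it is below them, has the signs of the cell.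
    have hpt : ∃ x ∈ (B : Set Plane) ∪ (R : Set Plane), (∀ i, dualPairing x (q i) ≠ 0) ∧
        ∀ i : ℕ, 0 < dualPairing x (q i) ↔ (a ↔ i ≤ j.val) := by
      have hTj := hT j hj
      by_cases hub : ub j ↔ ¬ a
      · refine ⟨b j, Or.inl (h.blue_mem j), h.blue_ne_zero j, fun i => ?_⟩
        rw [h.blue_pos, ← not_le]
        tauto
      · refine ⟨r j, Or.inr (h.red_mem j), h.red_ne_zero j, fun i => ?_⟩
        rw [h.red_pos, ← not_le]
        tauto
    obtain ⟨x, hx, hx0, hxpos⟩ := hpt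
    refine ⟨x, hx, hC.mem_of_same_sides hz ?_⟩
    rintro _ ⟨i, hi, rfl⟩
    have hzi := hcut i hi
    have hxi := hxpos i
    have nz := hC.dualPairing_ne_zero (hmem i hi) hz
    have nx := hx0 i
    rw [dualPairing_comm] at hxi nx
    have hiff : 0 < dualPairing (q i) z ↔ 0 < dualPairing (q i) x := by
      rw [hzi, hxi, Fin.le_def]
    rcases lt_or_gt_of_ne nz with h1 | h1
    · refine mul_pos_of_neg_of_neg h1 (lt_of_le_of_ne (not_lt.1 fun hh => ?_) nx)
      exact lt_asymm h1 (hiff.2 hh)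
    · exact mul_pos h1 (hiff.1 h1)
  · intro i hi j hj hij
    by_contra hne'
    exact hfst i hi j hj hne' (by rw [dualLine_injective hij])

end PairedCrossings

theorem mainTheorem6 (n k : ℕ) (B R : Finset Plane)
    (hsep : IsColorSeparable B R) (hn : B.card + R.card = 2 * n)
    (hpath : ContainsMSemialternatingPath (dualLine '' (B : Set Plane))
      (dualLine '' (R : Set Plane)) (2 * k)) :
    (∃ L : Finset PlaneSubspace,
      IsSpokeSet ((B : Set Plane) ∪ (R : Set Plane)) L ∧ (k : ℝ) / 2 ≤ (L.card : ℝ)) ∨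
    (∃ (m : ℕ) (L : Fin (m + 1) → PlaneSubspace),
      IsParallelSet B R m L ∧ (k : ℝ) / 2 ≤ (m : ℝ)) := by
  classical
  obtain ⟨b, r, q, ub, ur, h⟩ := exists_pairedCrossings hpath
  have hslope : ∀ i, (b i).1 ≠ (r i).1 := by
    intro i
    obtain ⟨-, c, ⟨hr, hb⟩ | ⟨hb, hr⟩⟩ := hsep
    · exact ((hr _ (h.red_mem i)).trans (hb _ (h.blue_mem i))).ne'
    · exact ((hb _ (h.blue_mem i)).trans (hr _ (h.red_mem i))).ne
  set S := Finset.univ.filter fun i => ub i ∧ ur i with hS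
  set T := Finset.univ.filter fun i => ¬ (ub i ∧ ur i) with hT
  have hcard : S.card + T.card = k := by
    rw [hS, hT, Finset.card_filter_add_card_filter_not, Finset.card_univ, Fintype.card_fin]
  have hcard' : (S.card : ℝ) + T.card = k := by exact_mod_cast hcard
  by_cases hbig : (k : ℝ) / 2 ≤ S.card
  · right
    obtain ⟨L, hL⟩ := h.isParallelSet (S := S) fun i hi => (Finset.mem_filter.1 hi).2
    exact ⟨_, L, hL, hbig⟩
  · left
    -- The set of spokes must not be empty: the whole plane is a cell of the empty arrangement.
    have hne : T.Nonempty := by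
      rw [← Finset.card_pos]
      by_contra h0
      have h1 : (T.card : ℝ) = 0 := by exact_mod_cast Nat.eq_zero_of_not_pos h0
      have h2 : (0 : ℝ) ≤ k := Nat.cast_nonneg k
      linarith
    obtain ⟨L, hL, hLcard⟩ := h.isSpokeSet hne (fun i hi => by
      have h1 := (Finset.mem_filter.1 hi).2
      have h2 := h.up i
      tauto) hslope
    exact ⟨L, hL, by rw [hLcard]; linarith⟩
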